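/- Let $x$ and $n$ be independent complex random variables on a probability space, where $n$ is circularly symmetric complex Gaussian with zero mean and unit variance (its real and imaginary parts are independent $\mathcal N(0,\tfrac12)$ variables). For $t>0$ put $y_t=\sqrt t\,x+n$ (the canonical AWGN channel at signal-to-noise ratio $t$) and let $$\mathrm{mmse}(t)=E\,\bigl|x-E[x\mid y_t]\bigr|^2,\qquad M[\mathrm{mmse};1+z]=\int_0^{\infty}t^{z}\,\mathrm{mmse}(t)\,dt .$$ Let $z\in\mathbb C$ with $\operatorname{Re} z>0$, and let ${}_2F_1$ denote the Gauss hypergeometric series. Then the series $$S(z)=\sum_{l=1}^{\infty}(-1)^l\,\frac{{}_2F_1\!\left(1,\tfrac12;2+z;1-\tfrac1{(1+2l)^2}\right)}{1+2l}$$ converges (as a limit of partial sums), and in each of the following cases the integral $M[\mathrm{mmse};1+z]$ converges absolutely and has the stated value. (a) If $x$ is uniformly distributed on $\{-\tfrac d2,\tfrac d2\}$ with $d>0$, then $$M[\mathrm{mmse};1+z]=\frac{d^2}{2}\left(\left(\frac2d\right)^{2(1+z)}\frac{\Gamma\left(\frac32+z\right)}{\sqrt\pi\,(1+z)}+2d^{-2(1+z)}\,\frac{\Gamma(2+2z)}{\Gamma(2+z)}\,S(z)\right).$$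 (b) (BPSK) If $x$ is uniformly distributed on $\{-1,1\}$, then $$M[\mathrm{mmse};1+z]=2\left(\frac{\Gamma\left(\frac32+z\right)}{\sqrt\pi\,(1+z)}+2^{-1-2z}\,\frac{\Gamma(2+2z)}{\Gamma(2+z)}\,S(z)\right).$$ (c) (QPSK) If $x$ is uniformly distributed on $\left\{\tfrac{\pm1\pm i}{\sqrt2}\right\}$ (all four sign choices), then $$M[\mathrm{mmse};1+z]=2^{2+z}\left(\frac{\Gamma\left(\frac32+z\right)}{\sqrt\pi\,(1+z)}+2^{-1-2z}\,\frac{\Gamma(2+2z)}{\Gamma(2+z)}\,S(z)\right).$$ -/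

import Mathlib

open MeasureTheory ProbabilityTheory Filter Topology
open scoped NNReal

noncomputable section

/-- The law of a circularly symmetric complex Gaussian random variable with zero mean and unit
variance: the real and imaginary parts are independent `N(0, 1/2)` random variables. -/
def stdComplexGaussian : Measure ℂ :=
  ((gaussianReal 0 (1 / 2)).prod (gaussianReal 0 (1 / 2))).map Complex.measurableEquivRealProd.symm

/-- The output `y = √snr x + n` of the canonical AWGN channel with input `x` and noise `n`. -/
def channelOutput {Ω : Type*} (x n : Ω → ℂ) (snr : ℝ) : Ω → ℂ :=
  fun ω => (Real.sqrt snr : ℂ) * x ω + n ω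

/-- The canonical MMSE `E |x - E[x | y]|²`, where `y` is the output of the canonical AWGN channel.
The conditioning is on the σ-algebra generated by `y`. -/
def canonicalMMSE {Ω : Type*} [MeasurableSpace Ω] (P : Measure Ω) (x n : Ω → ℂ) (snr : ℝ) : ℝ :=
  ∫ ω, ‖x ω - (P[x | MeasurableSpace.comap (channelOutput x n snr) inferInstance]) ω‖ ^ 2 ∂P

/-- The `l`-th term `(-1)^l ₂F₁(1, 1/2; 2 + z; 1 - 1/(1+2l)²) / (1 + 2l)`. -/
def hypergeometricTerm (z : ℂ) (l : ℕ) : ℂ :=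
  (-1) ^ l * (ordinaryHypergeometric (1 : ℂ) (1 / 2) (2 + z) (1 - 1 / (1 + 2 * (l : ℂ)) ^ 2 : ℂ)
    / (1 + 2 * (l : ℂ)))

/-- The points `(±1 ± i)/√2`. -/
def qpskConstellation : Set ℂ :=
  {-(1 / (Real.sqrt 2 : ℂ)) - Complex.I * (1 / (Real.sqrt 2 : ℂ)),
   1 / (Real.sqrt 2 : ℂ) - Complex.I * (1 / (Real.sqrt 2 : ℂ)),
   1 / (Real.sqrt 2 : ℂ) + Complex.I * (1 / (Real.sqrt 2 : ℂ)),
   -(1 / (Real.sqrt 2 : ℂ)) + Complex.I * (1 / (Real.sqrt 2 : ℂ))}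

end

/-! For inputs `±r`, Bayes' rule gives the conditional mean `r tanh(2a Re y)` with `a = √t r`.
Averaging the squared error leaves `r² binaryMMSE(r² t)`, a Gaussian integral against `1 / cosh`.
QPSK is two independent binary channels of amplitude `1/√2`, so its MMSE is `binaryMMSE(t/2)`. By
`HasMellin.const_mul_comp_mul_left`, all three cases reduce to the Mellin transform of `binaryMMSE`.

That transform is a double integral over `(s, t)`. Expand `1 / cosh u = 2 ∑ (-1)^l e^{-(1+2l)u}`.
With `m = 1 + 2l`, the `t`-integral of a term is a Gamma integral producing `(1 + 2ms +
s²)^{-(z+3/2)}`, and a substitution turns the remaining `s`-integral into Euler's integral for `₂F₁`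
at `1 - 1/m²` (`integral_mellinKernel_mul_exp`). The terms decay only like `1/l`, so the limit is
taken on partial sums: they are geometric, hence uniformly bounded, and dominated convergence yields
both the convergence of `S` and its value (`tendsto_sum_hypergeometricTerm`).

The result is `2 Γ(3/2+z) / (√π (1+z)) * (1 + S)`, the `1` being the term `l = 0`. Legendre
duplication rewrites the coefficient of `S` in the stated form. -/

/-! ### Euler's integral for the hypergeometric function -/

/-- The binomial series `∑ (a)ₙ xⁿ / n! = (1 - x)^(-a)`. -/
lemma hasSum_ascPochhammer_one_sub_cpow (a : ℂ) {x : ℂ} (hx : ‖x‖ < 1) :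
    HasSum (fun k : ℕ => (ascPochhammer ℂ k).eval a / (k.factorial : ℂ) * x ^ k)
      ((1 - x) ^ (-a)) := by
  have h := (Complex.one_div_one_sub_cpow_hasFPowerSeriesOnBall_zero a).hasSum (y := x)
    (by simpa [enorm_eq_nnnorm, ← NNReal.coe_lt_coe] using hx)
  rw [zero_add, one_div, ← Complex.cpow_neg] at h
  refine h.congr_fun fun k => ?_
  simp only [FormalMultilinearSeries.ofScalars_apply_eq, smul_eq_mul]
  congr 1
  have h1 := Ring.factorial_nsmul_multichoose_eq_ascPochhammer a k
  rw [Polynomial.ascPochhammer_smeval_eq_eval, nsmul_eq_mul] at h1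
  rw [← h1, mul_div_cancel_left₀ _ (by exact_mod_cast k.factorial_ne_zero), Ring.choose]
  congr 1
  ring

/-- A Beta integral with an integer parameter is a factorial over a finite product; splitting off
the factor `1 + z` leaves the Pochhammer symbol of `2 + z`. -/
lemma integral_pow_mul_one_sub_cpow {z : ℂ} (hz : 0 < z.re) (k : ℕ) :
    ∫ v in (0 : ℝ)..1, (v : ℂ) ^ k * (1 - (v : ℂ)) ^ z
      = (k.factorial : ℂ) / ((1 + z) * (ascPochhammer ℂ k).eval (2 + z)) := by
  have h1 : Complex.betaIntegral (k + 1) (z + 1)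
      = ∫ v in (0 : ℝ)..1, (v : ℂ) ^ k * (1 - (v : ℂ)) ^ z := by
    unfold Complex.betaIntegral
    simp
  rw [← h1, Complex.betaIntegral_symm,
    Complex.betaIntegral_eval_nat_add_one_right (by simp; linarith)]
  congr 1
  rw [Finset.prod_range_succ', mul_comm]
  congr 1
  · simp [add_comm]
  · clear h1
    induction k with
    | zero => simp
    | succ k ih =>
      rw [Finset.prod_range_succ, ih, ascPochhammer_succ_eval]
      push_cast
      ring

/-- Euler's integral for `₂F₁(1, b; 2 + z; x)`. -/
lemma integral_one_sub_cpow_mul_eq_ordinaryHypergeometric {z : ℂ} (hz : 0 < z.re) (b : ℂ)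
    {x : ℝ} (hx0 : 0 ≤ x) (hx1 : x < 1) :
    ∫ v in (0 : ℝ)..1, (1 - (v : ℂ)) ^ z * (1 - (x : ℂ) * v) ^ (-b)
      = ordinaryHypergeometric (1 : ℂ) b (2 + z) (x : ℂ) / (1 + z) := by
  set c : ℕ → ℂ := fun k => (ascPochhammer ℂ k).eval b / (k.factorial : ℂ) * (x : ℂ) ^ k with hc
  have hcs : Summable fun k => ‖c k‖ :=
    (hasSum_ascPochhammer_one_sub_cpow b (x := x) (by simpa [abs_of_nonneg hx0])).summable.norm
  have hmem : ∀ v ∈ Set.uIoc (0 : ℝ) 1, 0 ≤ v ∧ v ≤ 1 := by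
    intro v hv
    rw [Set.uIoc_of_le zero_le_one] at hv
    exact ⟨hv.1.le, hv.2⟩
  -- Termwise integration of the binomial series: `|v^k (1 - v)^z| ≤ 1` on `[0, 1]`, so `‖c k‖`
  -- dominates, and it is summable as `x < 1`.
  have key := intervalIntegral.hasSum_integral_of_dominated_convergence (a := 0) (b := 1)
    (μ := volume) (F := fun k (v : ℝ) => c k * ((v : ℂ) ^ k * (1 - (v : ℂ)) ^ z))
    (f := fun v : ℝ => (1 - (v : ℂ)) ^ z * (1 - (x : ℂ) * v) ^ (-b))
    (fun k _ => ‖c k‖) (fun k => by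
      refine Measurable.aestronglyMeasurable ?_
      fun_prop)
    (fun k => Eventually.of_forall fun v hv => by
      obtain ⟨h0, h1⟩ := hmem v hv
      rw [norm_mul]
      refine mul_le_of_le_one_right (norm_nonneg _) ?_
      rw [norm_mul, norm_pow, Complex.norm_real, Real.norm_of_nonneg h0]
      have : (1 - (v : ℂ)) = ((1 - v : ℝ) : ℂ) := by push_cast; rfl
      rw [this, Complex.norm_cpow_eq_rpow_re_of_nonneg (by linarith) hz.ne']
      exact mul_le_one₀ (pow_le_one₀ h0 h1) (Real.rpow_nonneg (by linarith) _)
        (Real.rpow_le_one (by linarith) (by linarith) hz.le))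
    (Eventually.of_forall fun _ _ => hcs) (by simp)
    (Eventually.of_forall fun v hv => by
      obtain ⟨h0, h1⟩ := hmem v hv
      have h2 := (hasSum_ascPochhammer_one_sub_cpow b (x := x * v) (by
        rw [norm_mul, Complex.norm_real, Complex.norm_real, Real.norm_of_nonneg h0,
          Real.norm_of_nonneg hx0]
        nlinarith)).mul_left ((1 - (v : ℂ)) ^ z)
      refine h2.congr_fun fun k => ?_
      simp only [hc]
      ring)
  rw [← key.tsum_eq, ordinaryHypergeometric_eq_tsum, ← tsum_div_const]
  refine tsum_congr fun k => ?_
  rw [intervalIntegral.integral_const_mul, integral_pow_mul_one_sub_cpow hz]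
  have hk : (k.factorial : ℂ) ≠ 0 := by exact_mod_cast k.factorial_ne_zero
  simp only [hc, ascPochhammer_eval_one, smul_eq_mul]
  field_simp

/-- The substitution `v = 1 - 1/(1 + 2ms + s²)` applied to Euler's integral. -/
lemma integral_quadratic_cpow {z : ℂ} (hz : 0 < z.re) {m : ℝ} (hm : 1 ≤ m) :
    ∫ s in Set.Ioi (0 : ℝ), ((1 + 2 * m * s + s ^ 2 : ℝ) : ℂ) ^ (-(z + 3 / 2))
      = ordinaryHypergeometric (1 : ℂ) (1 / 2) (2 + z) ((1 - 1 / m ^ 2 : ℝ) : ℂ)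
        / (2 * m * (1 + z)) := by
  have hm0 : 0 < m := by linarith
  have hQ : ∀ s ∈ Set.Ioi (0 : ℝ), 1 < 1 + 2 * m * s + s ^ 2 := by
    intro s hs
    have : 0 < s := hs
    have := mul_pos hm0 this
    nlinarith [sq_nonneg s]
  have himg : (fun s : ℝ => 1 - (1 + 2 * m * s + s ^ 2)⁻¹) '' Set.Ioi 0 = Set.Ioo 0 1 := by
    ext v
    constructor
    · rintro ⟨s, hs, rfl⟩
      have := hQ s hs
      exact ⟨by have := inv_lt_one_of_one_lt₀ this; linarith,
        by have : 0 < (1 + 2 * m * s + s ^ 2)⁻¹ := inv_pos.2 (by linarith)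
           linarith⟩
    · rintro ⟨h0, h1⟩
      have hw : 1 < (1 - v)⁻¹ := (one_lt_inv₀ (by linarith)).2 (by linarith)
      have hsq : Real.sqrt (m ^ 2 - 1 + (1 - v)⁻¹) ^ 2 = m ^ 2 - 1 + (1 - v)⁻¹ :=
        Real.sq_sqrt (by nlinarith)
      -- The positive root `s` of `1 + 2ms + s² = (1 - v)⁻¹`.
      refine ⟨-m + Real.sqrt (m ^ 2 - 1 + (1 - v)⁻¹), ?_, ?_⟩
      · have : m < Real.sqrt (m ^ 2 - 1 + (1 - v)⁻¹) := Real.lt_sqrt_of_sq_lt (by linarith)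
        simpa using this
      · have : 1 + 2 * m * (-m + Real.sqrt (m ^ 2 - 1 + (1 - v)⁻¹))
            + (-m + Real.sqrt (m ^ 2 - 1 + (1 - v)⁻¹)) ^ 2 = (1 - v)⁻¹ := by
          nlinarith
        simp only [this, inv_inv]
        ring
  have hderiv : ∀ s ∈ Set.Ioi (0 : ℝ), HasDerivWithinAt
      (fun s : ℝ => 1 - (1 + 2 * m * s + s ^ 2)⁻¹)
      ((2 * m + 2 * s) / (1 + 2 * m * s + s ^ 2) ^ 2) (Set.Ioi 0) s := by
    intro s hs
    have h1 : HasDerivAt (fun s : ℝ => 1 + 2 * m * s + s ^ 2) (2 * m + 2 * s) s := by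
      have := (((hasDerivAt_id s).const_mul (2 * m)).const_add 1).add (hasDerivAt_pow 2 s)
      simpa using! this
    have h2 := (h1.inv (by have := hQ s hs; linarith)).const_sub 1
    refine (h2.congr_deriv ?_).hasDerivWithinAt
    ring
  have hinj : Set.InjOn (fun s : ℝ => 1 - (1 + 2 * m * s + s ^ 2)⁻¹) (Set.Ioi 0) := by
    intro s hs t ht h
    have h1 : (1 + 2 * m * s + s ^ 2) = 1 + 2 * m * t + t ^ 2 := by
      have : (1 + 2 * m * s + s ^ 2)⁻¹ = (1 + 2 * m * t + t ^ 2)⁻¹ := by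
        simp only at h; linarith
      exact inv_injective this
    have h2 : (s - t) * (2 * m + s + t) = 0 := by linarith
    have hs' : 0 < s := hs
    have ht' : 0 < t := ht
    rcases mul_eq_zero.1 h2 with h3 | h3 <;> linarith
  have hx0 : 0 ≤ 1 - 1 / m ^ 2 := by
    have : 1 / m ^ 2 ≤ 1 := (div_le_one (by positivity)).2 (by nlinarith)
    linarith
  have hx1 : 1 - 1 / m ^ 2 < 1 := by
    have : 0 < 1 / m ^ 2 := by positivity
    linarith
  have hE := integral_one_sub_cpow_mul_eq_ordinaryHypergeometric hz (1 / 2) hx0 hx1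
  rw [intervalIntegral.integral_of_le zero_le_one, integral_Ioc_eq_integral_Ioo, ← himg,
    integral_image_eq_integral_abs_deriv_smul measurableSet_Ioi hderiv hinj] at hE
  have hm' : (m : ℂ) ≠ 0 := by exact_mod_cast hm0.ne'
  rw [mul_comm (2 * (m : ℂ)), ← div_div, ← hE, eq_div_iff (by simpa using hm'),
    ← integral_mul_const]
  refine setIntegral_congr_fun measurableSet_Ioi fun s hs => ?_
  have hs0 : 0 < s := hs
  have hQs := hQ s hs
  set Q : ℝ := 1 + 2 * m * s + s ^ 2 with hQdef
  have hQ0 : 0 < Q := by linarith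
  have e1 : (1 - ((1 - Q⁻¹ : ℝ) : ℂ)) = ((Q⁻¹ : ℝ) : ℂ) := by push_cast; ring
  -- The numerator is a perfect square, so the power `-1/2` yields `1 / (m + s)`, which cancels the
  -- factor `m + s` of the Jacobian.
  have e2 : (1 - ((1 - 1 / m ^ 2 : ℝ) : ℂ) * ((1 - Q⁻¹ : ℝ) : ℂ))
      = (((m + s) ^ 2 / (m ^ 2 * Q) : ℝ) : ℂ) := by
    have : 1 - (1 - 1 / m ^ 2) * (1 - Q⁻¹) = (m + s) ^ 2 / (m ^ 2 * Q) := by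
      field_simp
      rw [hQdef]; ring
    rw [← this]; push_cast; ring
  have e3 : (((m + s) ^ 2 / (m ^ 2 * Q) : ℝ) : ℂ) ^ (-(1 / 2 : ℂ))
      = ((m * Real.sqrt Q / (m + s) : ℝ) : ℂ) := by
    have : (-(1 / 2 : ℂ)) = ((-(1 / 2) : ℝ) : ℂ) := by push_cast; rfl
    rw [this, ← Complex.ofReal_cpow (by positivity), Real.rpow_neg (by positivity),
      ← Real.sqrt_eq_rpow, Real.sqrt_div (by positivity), Real.sqrt_mul (by positivity),
      Real.sqrt_sq (by positivity), Real.sqrt_sq (by positivity), inv_div]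
  have e4 : ((Q⁻¹ : ℝ) : ℂ) ^ z = (Q : ℂ) ^ (-z) := by
    rw [Complex.ofReal_inv, Complex.inv_cpow, Complex.cpow_neg]
    rw [Complex.arg_ofReal_of_nonneg hQ0.le]
    exact Real.pi_pos.ne
  have e5 : (Q : ℂ) ^ (-(z + 3 / 2)) = (Q : ℂ) ^ (-z) * ((Real.sqrt Q / Q ^ 2 : ℝ) : ℂ) := by
    have hQc : (Q : ℂ) ≠ 0 := by exact_mod_cast hQ0.ne'
    have : (-(z + 3 / 2)) = -z + ((1 / 2 - 2 : ℝ) : ℂ) := by push_cast; ring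
    rw [this, Complex.cpow_add _ _ hQc, ← Complex.ofReal_cpow hQ0.le, Real.rpow_sub hQ0,
      ← Real.sqrt_eq_rpow, Real.rpow_two]
  simp only [e1, e2]
  rw [e3, e4, e5, abs_of_nonneg (by positivity), Complex.real_smul]
  have : (2 * m + 2 * s) / Q ^ 2 * (m * Real.sqrt Q / (m + s)) = Real.sqrt Q / Q ^ 2 * (2 * m) := by
    have : m + s ≠ 0 := by positivity
    field_simp
  have hc : (((2 * m + 2 * s) / Q ^ 2 : ℝ) : ℂ) * ((m * Real.sqrt Q / (m + s) : ℝ) : ℂ)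
      = ((Real.sqrt Q / Q ^ 2 : ℝ) : ℂ) * (2 * m) := by
    rw [← Complex.ofReal_mul, this]; push_cast; ring
  linear_combination (-(Q : ℂ) ^ (-z)) * hc

/-! ### The series as a double integral over the quadrant -/

/-- The measure `ds dt` on the open quadrant `(0, ∞)²`. -/
noncomputable def quadrantMeasure : Measure (ℝ × ℝ) :=
  (volume.restrict (Set.Ioi 0)).prod (volume.restrict (Set.Ioi 0))

/-- The kernel `t ^ (z + 1/2) * exp (-t (1 + s²))` at `(s, t)`. -/
noncomputable def mellinKernel (z : ℂ) (p : ℝ × ℝ) : ℂ :=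
  (p.2 : ℂ) ^ (z + 1 / 2) * Complex.exp (-((1 + p.1 ^ 2 : ℝ) * p.2))

lemma ae_quadrantMeasure : ∀ᵐ p ∂quadrantMeasure, 0 < p.1 ∧ 0 < p.2 := by
  have h : ∀ᵐ s ∂(volume.restrict (Set.Ioi (0 : ℝ))), 0 < s := ae_restrict_mem measurableSet_Ioi
  exact (Measure.quasiMeasurePreserving_fst.ae h).and (Measure.quasiMeasurePreserving_snd.ae h)

lemma measurable_mellinKernel (z : ℂ) : Measurable (mellinKernel z) := by
  unfold mellinKernel
  fun_prop

lemma norm_mellinKernel {z : ℂ} (s : ℝ) {t : ℝ} (ht : 0 < t) :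
    ‖mellinKernel z (s, t)‖ = t ^ (z.re + 1 / 2) * Real.exp (-((1 + s ^ 2) * t)) := by
  unfold mellinKernel
  rw [norm_mul, Complex.norm_cpow_eq_rpow_re_of_pos ht, Complex.norm_exp]
  congr 2
  · simp
  · rw [← Complex.ofReal_mul, ← Complex.ofReal_neg, Complex.ofReal_re]

/-- The `t`-integral of the norm is a Gamma integral, bounded in `s` by a multiple of `1 / (1 +
s²)`. This justifies every use of Fubini and dominated convergence on the quadrant. -/
lemma integrable_mellinKernel {z : ℂ} (hz : 0 < z.re) :
    Integrable (mellinKernel z) quadrantMeasure := by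
  have hm := measurable_mellinKernel z
  unfold quadrantMeasure
  rw [integrable_prod_iff hm.aestronglyMeasurable]
  have hnorm : ∀ s : ℝ, ∫ t in Set.Ioi 0, ‖mellinKernel z (s, t)‖
      = (1 / (1 + s ^ 2)) ^ (z.re + 3 / 2) * Real.Gamma (z.re + 3 / 2) := by
    intro s
    rw [← Real.integral_rpow_mul_exp_neg_mul_Ioi (by linarith) (by positivity)]
    refine setIntegral_congr_fun measurableSet_Ioi fun t ht => ?_
    rw [norm_mellinKernel s ht]
    congr 2
    ring
  constructor
  · refine Eventually.of_forall fun s => ?_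
    have hsm : AEStronglyMeasurable (fun t => mellinKernel z (s, t))
        (volume.restrict (Set.Ioi 0)) := (hm.comp measurable_prodMk_left).aestronglyMeasurable
    rw [← integrable_norm_iff hsm]
    -- A non-integrable function has integral `0` by convention, whereas the value computed in
    -- `hnorm` is positive.
    by_contra h
    have h0 := integral_undef h
    have h1 := hnorm s
    rw [h0] at h1
    have : 0 < (1 / (1 + s ^ 2)) ^ (z.re + 3 / 2) * Real.Gamma (z.re + 3 / 2) :=
      mul_pos (Real.rpow_pos_of_pos (by positivity) _) (Real.Gamma_pos_of_pos (by linarith))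
    linarith
  · simp only [hnorm]
    refine Integrable.mul_const ?_ _
    refine Integrable.mono' integrable_inv_one_add_sq.restrict
      (by refine Measurable.aestronglyMeasurable ?_; fun_prop) (Eventually.of_forall fun s => ?_)
    rw [Real.norm_of_nonneg (by positivity)]
    have h1 : 1 / (1 + s ^ 2) ≤ 1 := (div_le_one (by positivity)).2 (by nlinarith)
    calc (1 / (1 + s ^ 2)) ^ (z.re + 3 / 2) ≤ (1 / (1 + s ^ 2)) ^ (1 : ℝ) :=
          Real.rpow_le_rpow_of_exponent_ge (by positivity) h1 (by linarith)
      _ = (1 + s ^ 2)⁻¹ := by rw [Real.rpow_one, one_div]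

lemma Integrable.mellinKernel_mul {z : ℂ} (hz : 0 < z.re) {f : ℝ × ℝ → ℂ} (hf : Measurable f)
    {C : ℝ} (hC : ∀ p : ℝ × ℝ, 0 < p.1 → 0 < p.2 → ‖f p‖ ≤ C) :
    Integrable (fun p => mellinKernel z p * f p) quadrantMeasure :=
  (integrable_mellinKernel hz).mul_bdd (c := C) hf.aestronglyMeasurable
    (ae_quadrantMeasure.mono fun p hp => hC p hp.1 hp.2)

lemma norm_exp_neg_mul_le_one {m : ℝ} (hm : 0 ≤ m) {p : ℝ × ℝ} (h1 : 0 < p.1) (h2 : 0 < p.2) :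
    ‖Complex.exp (-(2 * m * p.2 * p.1 : ℝ))‖ ≤ 1 := by
  rw [Complex.norm_exp, ← Complex.ofReal_neg, Complex.ofReal_re, Real.exp_le_one_iff]
  have := mul_nonneg (mul_nonneg hm h2.le) h1.le
  linarith

/-- Integrating in `t` first, the exponents combine to `-(1 + 2ms + s²) t`, a Gamma integral;
`integral_quadratic_cpow` does the rest. -/
lemma integral_mellinKernel_mul_exp {z : ℂ} (hz : 0 < z.re) {m : ℝ} (hm : 1 ≤ m) :
    ∫ p, mellinKernel z p * Complex.exp (-(2 * m * p.2 * p.1 : ℝ)) ∂quadrantMeasure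
      = Complex.Gamma (3 / 2 + z) / (2 * (1 + z)) *
        (ordinaryHypergeometric (1 : ℂ) (1 / 2) (2 + z) ((1 - 1 / m ^ 2 : ℝ) : ℂ) / m) := by
  have hint := Integrable.mellinKernel_mul hz
    (f := fun p : ℝ × ℝ => Complex.exp (-(2 * m * p.2 * p.1 : ℝ))) (by fun_prop)
    (fun p => norm_exp_neg_mul_le_one (by linarith))
  unfold quadrantMeasure at hint ⊢
  rw [integral_prod _ hint]
  have hin : ∀ s ∈ Set.Ioi (0 : ℝ), ∫ t in Set.Ioi (0 : ℝ),
      mellinKernel z (s, t) * Complex.exp (-(2 * m * t * s : ℝ))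
      = ((1 + 2 * m * s + s ^ 2 : ℝ) : ℂ) ^ (-(z + 3 / 2)) * Complex.Gamma (3 / 2 + z) := by
    intro s hs
    have hs0 : 0 < s := hs
    have hQ : 0 < 1 + 2 * m * s + s ^ 2 := by positivity
    have h := Complex.integral_cpow_mul_exp_neg_mul_Ioi (a := z + 3 / 2)
      (by simp; linarith) hQ
    rw [one_div, Complex.inv_cpow _ _ (by
      rw [Complex.arg_ofReal_of_nonneg hQ.le]; exact Real.pi_pos.ne), ← Complex.cpow_neg,
      add_comm z] at h
    rw [add_comm z, ← h]
    refine setIntegral_congr_fun measurableSet_Ioi fun t ht => ?_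
    simp only [mellinKernel]
    rw [mul_assoc, ← Complex.exp_add]
    congr 2
    · ring
    · push_cast; ring
  rw [setIntegral_congr_fun measurableSet_Ioi hin, integral_mul_const, integral_quadratic_cpow hz hm]
  have : (m : ℂ) ≠ 0 := by exact_mod_cast (by linarith : m ≠ 0)
  have : (1 + z) ≠ 0 := by
    intro h
    have := congrArg Complex.re h
    simp at this
    linarith
  field_simp

lemma hypergeometricTerm_eq_integral {z : ℂ} (hz : 0 < z.re) (l : ℕ) :
    ∫ p, mellinKernel z p * ((-1) ^ l * Complex.exp (-(2 * (1 + 2 * l) * p.2 * p.1 : ℝ)))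
        ∂quadrantMeasure
      = Complex.Gamma (3 / 2 + z) / (2 * (1 + z)) * hypergeometricTerm z l := by
  have h := integral_mellinKernel_mul_exp hz (m := 1 + 2 * l) (by
    have : (0 : ℝ) ≤ l := Nat.cast_nonneg l
    linarith)
  simp_rw [mul_left_comm _ ((-1 : ℂ) ^ l)]
  rw [integral_const_mul, h, hypergeometricTerm]
  push_cast
  ring

/-- The partial sums of `2 ∑ (-1)^l e^{-(1 + 2l) u} = 1 / cosh u`. -/
lemma sum_neg_one_pow_mul_exp (u : ℝ) (L : ℕ) :
    ∑ l ∈ Finset.range L, (-1 : ℝ) ^ l * Real.exp (-((1 + 2 * l) * u))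
      = (1 - (-Real.exp (-(2 * u))) ^ L) / (2 * Real.cosh u) := by
  have h0 : -Real.exp (-(2 * u)) ≠ 1 := by
    have := Real.exp_pos (-(2 * u))
    linarith
  have h1 : ∀ l : ℕ, (-1 : ℝ) ^ l * Real.exp (-((1 + 2 * l) * u))
      -- A geometric progression of ratio `-e^{-2u}`.
      = Real.exp (-u) * (-Real.exp (-(2 * u))) ^ l := by
    intro l
    rw [neg_pow (Real.exp _), ← Real.exp_nat_mul, mul_left_comm, ← Real.exp_add]
    congr 2
    ring
  have h2 : Real.exp (-u) * Real.exp (-u) = Real.exp (-(2 * u)) := by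
    rw [← Real.exp_add]; congr 1; ring
  have h3 : Real.exp u * Real.exp (-u) = 1 := by rw [← Real.exp_add]; simp
  simp_rw [h1]
  rw [← Finset.mul_sum, geom_sum_eq h0, Real.cosh_eq]
  have h4 := Real.exp_pos u
  have h5 := Real.exp_pos (-u)
  have h6 := Real.exp_pos (-(2 * u))
  have h7 : -Real.exp (-(2 * u)) - 1 ≠ 0 := by linarith
  rw [mul_div_assoc', div_eq_div_iff h7 (by positivity)]
  linear_combination (((-Real.exp (-(2 * u))) ^ L) - 1) * (h2 + h3)

/-- The closed form of the alternating partial sums is at most `2 / (2 cosh) ≤ 1` in absolute value,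
so the kernel alone dominates; no absolute convergence of the series is needed. -/
lemma tendsto_sum_hypergeometricTerm {z : ℂ} (hz : 0 < z.re) :
    Tendsto (fun L : ℕ => Complex.Gamma (3 / 2 + z) / (2 * (1 + z)) *
        ∑ l ∈ Finset.range L, hypergeometricTerm z l) atTop
      (𝓝 (∫ p, mellinKernel z p * ((1 / (2 * Real.cosh (2 * p.2 * p.1)) : ℝ) : ℂ)
        ∂quadrantMeasure)) := by
  have hF : ∀ L : ℕ, Complex.Gamma (3 / 2 + z) / (2 * (1 + z)) *
        ∑ l ∈ Finset.range L, hypergeometricTerm z l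
      = ∫ p, mellinKernel z p * (((1 - (-Real.exp (-(2 * (2 * p.2 * p.1)))) ^ L)
          / (2 * Real.cosh (2 * p.2 * p.1)) : ℝ) : ℂ) ∂quadrantMeasure := by
    intro L
    rw [Finset.mul_sum]
    simp_rw [← hypergeometricTerm_eq_integral hz]
    rw [← integral_finsetSum]
    · refine integral_congr_ae (Eventually.of_forall fun p => ?_)
      simp only
      rw [← sum_neg_one_pow_mul_exp, ← Finset.mul_sum]
      congr 1
      push_cast
      refine Finset.sum_congr rfl fun l _ => ?_
      congr 2
      ring
    · intro l _
      refine Integrable.mellinKernel_mul hz (C := 1) (by fun_prop) fun p h1 h2 => ?_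
      rw [norm_mul]
      simpa using norm_exp_neg_mul_le_one (m := 1 + 2 * l) (by positivity) h1 h2
  simp_rw [hF]
  have hlt : ∀ p : ℝ × ℝ, 0 < p.1 → 0 < p.2 → ‖-Real.exp (-(2 * (2 * p.2 * p.1)))‖ < 1 := by
    intro p h1 h2
    rw [norm_neg, Real.norm_of_nonneg (Real.exp_pos _).le, Real.exp_lt_one_iff]
    have := mul_pos h2 h1
    linarith
  refine tendsto_integral_of_dominated_convergence (fun p => ‖mellinKernel z p‖) (fun L => ?_)
    (integrable_mellinKernel hz).norm (fun L => ?_) ?_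
  · refine Measurable.aestronglyMeasurable ((measurable_mellinKernel z).mul ?_)
    fun_prop
  · filter_upwards [ae_quadrantMeasure] with p hp
    rw [norm_mul]
    refine mul_le_of_le_one_right (norm_nonneg _) ?_
    rw [Complex.norm_real, norm_div, Real.norm_of_nonneg (by positivity : 0 ≤ 2 * Real.cosh _)]
    have h1 := Real.one_le_cosh (2 * p.2 * p.1)
    rw [div_le_one (by positivity)]
    have h2 : ‖(-Real.exp (-(2 * (2 * p.2 * p.1)))) ^ L‖ ≤ 1 := by
      rw [norm_pow]
      exact pow_le_one₀ (norm_nonneg _) (hlt p hp.1 hp.2).le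
    calc _ ≤ ‖(1 : ℝ)‖ + ‖(-Real.exp (-(2 * (2 * p.2 * p.1)))) ^ L‖ := norm_sub_le _ _
      _ ≤ 2 * Real.cosh (2 * p.2 * p.1) := by rw [norm_one]; linarith
  · filter_upwards [ae_quadrantMeasure] with p hp
    refine Tendsto.const_mul _ ((Complex.continuous_ofReal.tendsto _).comp ?_)
    have := tendsto_pow_atTop_nhds_zero_of_norm_lt_one (hlt p hp.1 hp.2)
    simpa using (this.const_sub 1).div_const (2 * Real.cosh (2 * p.2 * p.1))

/-! ### Mellin transform of the binary MMSE -/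

/-- The MMSE of a unit-power binary input at signal-to-noise ratio `τ`. -/
noncomputable def binaryMMSE (τ : ℝ) : ℝ :=
  ∫ s in Set.Ioi (0 : ℝ), 2 * Real.sqrt (τ / Real.pi) * Real.exp (-((1 + s ^ 2) * τ))
    / Real.cosh (2 * τ * s)

/-- The `√t` in `binaryMMSE` raises `t^z` to `t^(z + 1/2)`; the constant is `4` rather than `2`
because the integrand carries `1 / (2 cosh)`. -/
lemma cpow_smul_binaryMMSE (z : ℂ) {t : ℝ} (ht : 0 < t) :
    (t : ℂ) ^ (1 + z - 1) • (binaryMMSE t : ℂ)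
      = ∫ s in Set.Ioi (0 : ℝ), (4 / Real.sqrt Real.pi : ℂ) *
        (mellinKernel z (s, t) * ((1 / (2 * Real.cosh (2 * t * s)) : ℝ) : ℂ)) := by
  rw [binaryMMSE, ← integral_complex_ofReal, smul_eq_mul, ← integral_const_mul]
  refine integral_congr_ae (Eventually.of_forall fun s => ?_)
  have ht' : (t : ℂ) ≠ 0 := by exact_mod_cast ht.ne'
  have hh : (t : ℂ) ^ (1 / 2 : ℂ) = (Real.sqrt t : ℂ) := by
    rw [Real.sqrt_eq_rpow, Complex.ofReal_cpow ht.le]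
    push_cast; rfl
  have hc : Complex.cosh (2 * t * s) ≠ 0 := by
    have : ((Real.cosh (2 * t * s) : ℝ) : ℂ) ≠ 0 := by
      exact_mod_cast (Real.cosh_pos _).ne'
    simpa using this
  have hp : (Real.sqrt Real.pi : ℂ) ≠ 0 := by
    exact_mod_cast (Real.sqrt_pos.2 Real.pi_pos).ne'
  simp only [mellinKernel]
  rw [Complex.cpow_add _ _ ht', hh, Real.sqrt_div ht.le, add_sub_cancel_left]
  push_cast
  field_simp
  norm_num
  ring

/-- The Mellin transform of the binary MMSE. -/
lemma hasMellin_binaryMMSE {z : ℂ} (hz : 0 < z.re) :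
    HasMellin (fun t => (binaryMMSE t : ℂ)) (1 + z) ((4 / Real.sqrt Real.pi : ℂ) *
      ∫ p, mellinKernel z p * ((1 / (2 * Real.cosh (2 * p.2 * p.1)) : ℝ) : ℂ)
        ∂quadrantMeasure) := by
  have hint : Integrable (fun p => (4 / Real.sqrt Real.pi : ℂ) *
      (mellinKernel z p * ((1 / (2 * Real.cosh (2 * p.2 * p.1)) : ℝ) : ℂ))) quadrantMeasure := by
    refine (Integrable.mellinKernel_mul hz (C := 1) (by fun_prop) fun p _ _ => ?_).const_mul _
    rw [Complex.norm_real, Real.norm_of_nonneg (by positivity), div_le_one (by positivity)]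
    linarith [Real.one_le_cosh (2 * p.2 * p.1)]
  rw [← integral_const_mul]
  unfold quadrantMeasure at hint ⊢
  have hcongr : Set.EqOn (fun t : ℝ => (t : ℂ) ^ (1 + z - 1) • (binaryMMSE t : ℂ)) _ (Set.Ioi 0) :=
    fun t ht => cpow_smul_binaryMMSE z ht
  constructor
  · rw [MellinConvergent, integrableOn_congr_fun hcongr measurableSet_Ioi]
    exact hint.integral_prod_right
  · rw [mellin, setIntegral_congr_fun measurableSet_Ioi hcongr, integral_prod_symm _ hint]

/-- The Legendre duplication formula, in the form needed. -/
lemma two_cpow_mul_Gamma_div_Gamma {z : ℂ} (hz : 0 < z.re) :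
    (2 : ℂ) ^ (-1 - 2 * z) * (Complex.Gamma (2 + 2 * z) / Complex.Gamma (2 + z))
      = Complex.Gamma (3 / 2 + z) / ((Real.sqrt Real.pi : ℂ) * (1 + z)) := by
  have h1 := Complex.Gamma_mul_Gamma_add_half (1 + z)
  have hz1 : 1 + z ≠ 0 := by
    intro h
    have := congrArg Complex.re h
    simp at this
    linarith
  have h2 : Complex.Gamma (2 + z) = (1 + z) * Complex.Gamma (1 + z) := by
    rw [← Complex.Gamma_add_one _ hz1]; congr 1; ring
  have hg : Complex.Gamma (1 + z) ≠ 0 := Complex.Gamma_ne_zero_of_re_pos (by simp; linarith)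
  have hp : (Real.sqrt Real.pi : ℂ) ≠ 0 := by
    exact_mod_cast (Real.sqrt_pos.2 Real.pi_pos).ne'
  rw [show 1 + z + 1 / 2 = 3 / 2 + z by ring, show 2 * (1 + z) = 2 + 2 * z by ring,
    show 1 - (2 + 2 * z) = -1 - 2 * z by ring] at h1
  rw [h2, mul_div_assoc', div_eq_div_iff (mul_ne_zero hz1 hg) (mul_ne_zero hp hz1)]
  linear_combination -(1 + z) * h1

/-! ### The Gaussian channel and its conditional mean -/

/-- The density of `N(0, 1/2)`. -/
noncomputable def halfGaussianPDF : ℝ → ℝ := gaussianPDFReal 0 (1 / 2)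

lemma halfGaussianPDF_eq (v : ℝ) :
    halfGaussianPDF v = (Real.sqrt Real.pi)⁻¹ * Real.exp (-v ^ 2) := by
  have h : (2 * Real.pi * ((1 / 2 : ℝ≥0) : ℝ)) = Real.pi := by push_cast; ring
  have h' : (2 * ((1 / 2 : ℝ≥0) : ℝ)) = 1 := by push_cast; ring
  rw [halfGaussianPDF, gaussianPDFReal_def]
  simp only [h, h', sub_zero, div_one]

lemma integrable_halfGaussianPDF : Integrable halfGaussianPDF := integrable_gaussianPDFReal _ _

lemma integral_halfGaussianPDF : ∫ v, halfGaussianPDF v = 1 :=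
  integral_gaussianPDFReal_eq_one _ (by norm_num)

/-- The density, at `p = (Re y, Im y)`, of the output `y` given the scaled input `c`. -/
noncomputable def channelPDF (c : ℂ) (p : ℝ × ℝ) : ℝ :=
  halfGaussianPDF (p.1 - c.re) * halfGaussianPDF (p.2 - c.im)

lemma integrable_channelPDF (c : ℂ) : Integrable (channelPDF c) :=
  (integrable_halfGaussianPDF.comp_sub_right c.re).mul_prod
    (integrable_halfGaussianPDF.comp_sub_right c.im)

section
variable {E : Type*} [NormedAddCommGroup E] [NormedSpace ℝ E]

lemma integral_stdComplexGaussian (f : ℂ → E) :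
    ∫ w, f w ∂stdComplexGaussian
      = ∫ p : ℝ × ℝ, channelPDF 0 p • f (Complex.measurableEquivRealProd.symm p) := by
  unfold stdComplexGaussian
  have h2 : (1 / 2 : ℝ≥0) ≠ 0 := by norm_num
  rw [integral_map_equiv, gaussianReal_of_var_ne_zero _ h2,
    prod_withDensity (measurable_gaussianPDF _ _) (measurable_gaussianPDF _ _),
    integral_withDensity_eq_integral_toReal_smul (by
      have := measurable_gaussianPDF 0 (1 / 2)
      fun_prop) (Eventually.of_forall fun p =>
        ENNReal.mul_lt_top (gaussianPDF_lt_top) (gaussianPDF_lt_top))]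
  simp [channelPDF, halfGaussianPDF, ENNReal.toReal_mul, toReal_gaussianPDF, Measure.volume_eq_prod]

/-- Translation invariance of Lebesgue measure moves the shift by `c` from the argument of `f` to
the density. -/
lemma integral_add_stdComplexGaussian (c : ℂ) (f : ℂ → E) :
    ∫ w, f (c + w) ∂stdComplexGaussian
      = ∫ p : ℝ × ℝ, channelPDF c p • f (Complex.measurableEquivRealProd.symm p) := by
  rw [integral_stdComplexGaussian (fun w => f (c + w)),
    ← integral_add_right_eq_self (fun p : ℝ × ℝ =>
      channelPDF c p • f (Complex.measurableEquivRealProd.symm p)) (c.re, c.im)]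
  refine integral_congr_ae (Eventually.of_forall fun p => ?_)
  have h : Complex.measurableEquivRealProd.symm (p + (c.re, c.im))
      = c + Complex.measurableEquivRealProd.symm p := by
    apply Complex.ext <;> simp [Complex.measurableEquivRealProd_symm_apply, add_comm]
  simp only [h, channelPDF]
  simp

lemma integral_uniformOn_finset [CompleteSpace E] (s : Finset ℂ) (f : ℂ → E) :
    ∫ a, f a ∂(uniformOn (s : Set ℂ)) = (s.card : ℝ)⁻¹ • ∑ a ∈ s, f a := by
  rw [uniformOn, ProbabilityTheory.cond, integral_smul_measure, setIntegral_finset]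
  · simp [Measure.count_apply_finset, Measure.real]
  · rw [← Set.biUnion_of_singleton (s : Set ℂ)]
    exact integrableOn_finset_iUnion.2 fun a _ => integrableOn_singleton (hx := by simp)

variable {Ω : Type*} [MeasurableSpace Ω] {P : Measure Ω}
  {x n : Ω → ℂ}

instance : IsProbabilityMeasure stdComplexGaussian := by
  unfold stdComplexGaussian
  exact Measure.isProbabilityMeasure_map (by fun_prop)

lemma measurable_channelOutput (hx : Measurable x) (hn : Measurable n) (t : ℝ) :
    Measurable (channelOutput x n t) := by
  unfold channelOutput
  fun_prop

lemma ae_mem_of_map_eq_uniformOn (hx : Measurable x) {s : Finset ℂ}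
    (hlaw : P.map x = uniformOn (s : Set ℂ)) : ∀ᵐ ω ∂P, x ω ∈ s := by
  refine ae_of_ae_map (p := fun a => a ∈ s) hx.aemeasurable ?_
  rw [hlaw, uniformOn]
  exact ae_cond_mem s.measurableSet

/-- The joint law of the input and the output of the channel. -/
lemma integral_channel [CompleteSpace E] [IsProbabilityMeasure P] (hx : Measurable x) (hn : Measurable n) (hxn : IndepFun x n P)
    (hnoise : P.map n = stdComplexGaussian) {s : Finset ℂ} (hs : s.Nonempty)
    (hlaw : P.map x = uniformOn (s : Set ℂ)) (t : ℝ) {f : ℂ → ℂ → E}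
    (hf : StronglyMeasurable (Function.uncurry f)) {C : ℝ} (hC : ∀ a ∈ s, ∀ y, ‖f a y‖ ≤ C) :
    ∫ ω, f (x ω) (channelOutput x n t ω) ∂P
      = (s.card : ℝ)⁻¹ • ∑ a ∈ s, ∫ p : ℝ × ℝ, channelPDF ((Real.sqrt t : ℂ) * a) p •
          f a (Complex.measurableEquivRealProd.symm p) := by
  have hg : StronglyMeasurable (fun q : ℂ × ℂ => f q.1 ((Real.sqrt t : ℂ) * q.1 + q.2)) :=
    hf.comp_measurable (g := fun q : ℂ × ℂ => (q.1, (Real.sqrt t : ℂ) * q.1 + q.2)) (by fun_prop)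
  have hprod := (indepFun_iff_map_prod_eq_prod_map_map hx.aemeasurable hn.aemeasurable).1 hxn
  have h1 : ∫ ω, f (x ω) (channelOutput x n t ω) ∂P
      = ∫ q, f q.1 ((Real.sqrt t : ℂ) * q.1 + q.2) ∂(P.map fun ω => (x ω, n ω)) := by
    rw [integral_map (by fun_prop) hg.aestronglyMeasurable]
    rfl
  have hprob : IsProbabilityMeasure (uniformOn (s : Set ℂ)) :=
    isProbabilityMeasure_uniformOn s.finite_toSet hs
  rw [h1, hprod, hlaw, hnoise, integral_prod, integral_uniformOn_finset]
  · simp_rw [integral_add_stdComplexGaussian]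
  · refine Integrable.of_bound hg.aestronglyMeasurable C ?_
    have hmem : ∀ᵐ a ∂(uniformOn (s : Set ℂ)), a ∈ s := by
      rw [uniformOn]
      exact ae_cond_mem s.measurableSet
    filter_upwards [Measure.quasiMeasurePreserving_fst.ae hmem] with q hq using hC _ hq _

/-- A bounded decision function satisfying Bayes' rule is the conditional mean. -/
lemma condExp_channel [IsProbabilityMeasure P] (hx : Measurable x) (hn : Measurable n) (hxn : IndepFun x n P)
    (hnoise : P.map n = stdComplexGaussian) {s : Finset ℂ} (hs : s.Nonempty)
    (hlaw : P.map x = uniformOn (s : Set ℂ)) (t : ℝ) {g : ℂ → ℂ} (hg : Measurable g) {C : ℝ}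
    (hC : ∀ y, ‖g y‖ ≤ C)
    (hbayes : ∀ p : ℝ × ℝ, ∑ a ∈ s, (channelPDF ((Real.sqrt t : ℂ) * a) p : ℂ) *
      (g (Complex.measurableEquivRealProd.symm p) - a) = 0) :
    (fun ω => g (channelOutput x n t ω))
      =ᵐ[P] P[x | MeasurableSpace.comap (channelOutput x n t) inferInstance] := by
  have hy := measurable_channelOutput hx hn t
  obtain ⟨R, hR⟩ : ∃ R, ∀ a ∈ s, ‖a‖ ≤ R :=
    ⟨∑ a ∈ s, ‖a‖, fun a ha => Finset.single_le_sum (f := fun a => ‖a‖)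
      (fun _ _ => norm_nonneg _) ha⟩
  have hxint : Integrable x P := Integrable.of_bound hx.aestronglyMeasurable R
    ((ae_mem_of_map_eq_uniformOn hx hlaw).mono fun ω h => hR _ h)
  have hgint : Integrable (fun ω => g (channelOutput x n t ω)) P :=
    Integrable.of_bound (hg.comp hy).aestronglyMeasurable C (Eventually.of_forall fun _ => hC _)
  refine ae_eq_condExp_of_forall_setIntegral_eq hy.comap_le hxint
    (fun _ _ _ => hgint.integrableOn) ?_
    (hg.comp (comap_measurable _)).aestronglyMeasurable
  rintro _ ⟨B, hB, rfl⟩ -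
  rw [← sub_eq_zero, ← integral_sub hgint.integrableOn hxint.integrableOn,
    ← integral_indicator (hy hB)]
  have h1 : ∀ ω, (channelOutput x n t ⁻¹' B).indicator
      (fun ω => g (channelOutput x n t ω) - x ω) ω
      = (fun a y => B.indicator (fun y => g y - a) y) (x ω) (channelOutput x n t ω) := by
    intro ω
    by_cases h : channelOutput x n t ω ∈ B <;> simp [Set.indicator, h]
  have hbd : ∀ a ∈ s, ∀ y, ‖B.indicator (fun y => g y - a) y‖ ≤ C + R := by
    intro a ha y
    refine (norm_indicator_le_norm_self _ _).trans ((norm_sub_le _ _).trans ?_)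
    exact add_le_add (hC y) (hR a ha)
  have hms : Measurable (Function.uncurry fun (a y : ℂ) => B.indicator (fun y => g y - a) y) := by
    have : (Function.uncurry fun (a y : ℂ) => B.indicator (fun y => g y - a) y)
        = (Prod.snd ⁻¹' B).indicator (fun q : ℂ × ℂ => g q.2 - q.1) := by
      ext q
      by_cases h : q.2 ∈ B <;> simp [Function.uncurry, Set.indicator, h]
    rw [this]
    exact Measurable.indicator (by fun_prop) (measurable_snd hB)
  simp_rw [h1]
  rw [integral_channel hx hn hxn hnoise hs hlaw t
    (f := fun a y => B.indicator (fun y => g y - a) y) hms.stronglyMeasurable hbd,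
    ← integral_finsetSum]
  · rw [smul_eq_zero]
    right
    -- The integrand vanishes pointwise: on `B` it is the sum in `hbayes`.
    refine integral_eq_zero_of_ae (Eventually.of_forall fun p => ?_)
    simp only [Complex.real_smul, Pi.zero_apply]
    by_cases hp : Complex.measurableEquivRealProd.symm p ∈ B
    · simp only [Set.indicator_of_mem hp]
      exact hbayes p
    · simp only [Set.indicator_of_notMem hp, mul_zero, Finset.sum_const_zero]
  · intro a ha
    refine (integrable_channelPDF _).smul_bdd (C + R) ?_
      (Eventually.of_forall fun p => hbd a ha _)
    exact (hms.comp (measurable_prodMk_left.comp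
      Complex.measurableEquivRealProd.symm.measurable)).aestronglyMeasurable

/-- The MMSE of a finite uniform constellation, in terms of the conditional mean. -/
lemma canonicalMMSE_eq_integral [IsProbabilityMeasure P] (hx : Measurable x) (hn : Measurable n) (hxn : IndepFun x n P)
    (hnoise : P.map n = stdComplexGaussian) {s : Finset ℂ} (hs : s.Nonempty)
    (hlaw : P.map x = uniformOn (s : Set ℂ)) (t : ℝ) {g : ℂ → ℂ} (hg : Measurable g) {C : ℝ}
    (hC : ∀ y, ‖g y‖ ≤ C)
    (hbayes : ∀ p : ℝ × ℝ, ∑ a ∈ s, (channelPDF ((Real.sqrt t : ℂ) * a) p : ℂ) *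
      (g (Complex.measurableEquivRealProd.symm p) - a) = 0) :
    canonicalMMSE P x n t = (s.card : ℝ)⁻¹ * ∫ p : ℝ × ℝ, ∑ a ∈ s,
      channelPDF ((Real.sqrt t : ℂ) * a) p *
        ‖a - g (Complex.measurableEquivRealProd.symm p)‖ ^ 2 := by
  have hc := condExp_channel hx hn hxn hnoise hs hlaw t hg hC hbayes
  obtain ⟨R, hR⟩ : ∃ R, ∀ a ∈ s, ‖a‖ ≤ R :=
    ⟨∑ a ∈ s, ‖a‖, fun a ha => Finset.single_le_sum (f := fun a => ‖a‖)
      (fun _ _ => norm_nonneg _) ha⟩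
  have hbd : ∀ a ∈ s, ∀ y, ‖‖a - g y‖ ^ 2‖ ≤ (R + C) ^ 2 := by
    intro a ha y
    rw [norm_pow, norm_norm]
    exact pow_le_pow_left₀ (norm_nonneg _)
      ((norm_sub_le _ _).trans (add_le_add (hR a ha) (hC y))) 2
  have h1 : canonicalMMSE P x n t
      = ∫ ω, (fun a y => ‖a - g y‖ ^ 2) (x ω) (channelOutput x n t ω) ∂P := by
    refine integral_congr_ae ?_
    filter_upwards [hc] with ω hω
    simp only [← hω]
  rw [h1, integral_channel hx hn hxn hnoise hs hlaw t (f := fun a y => ‖a - g y‖ ^ 2)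
    (Measurable.stronglyMeasurable (by unfold Function.uncurry; fun_prop)) hbd, smul_eq_mul,
    integral_finsetSum]
  · simp
  · intro a ha
    refine (integrable_channelPDF _).mul_bdd (c := (R + C) ^ 2) ?_
      (Eventually.of_forall fun p => hbd a ha _)
    refine Measurable.aestronglyMeasurable ?_
    have := Complex.measurableEquivRealProd.symm.measurable
    fun_prop

end

/-! ### MMSE of binary and QPSK inputs -/

@[fun_prop]
lemma measurable_tanh : Measurable Real.tanh := by
  have : Real.tanh = fun v => Real.sinh v / Real.cosh v := funext Real.tanh_eq_sinh_div_cosh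
  rw [this]
  fun_prop

/-- Pulling out the factors even in `a` leaves `e^{±2av}` for the inputs `±a`, the source of `tanh`
and `cosh`. -/
lemma halfGaussianPDF_sub (v a : ℝ) :
    halfGaussianPDF (v - a)
      = halfGaussianPDF v * Real.exp (-a ^ 2) * Real.exp (2 * a * v) := by
  simp only [halfGaussianPDF_eq]
  rw [mul_assoc, mul_assoc, ← Real.exp_add, ← Real.exp_add]
  congr 2
  ring

lemma tanh_sub_one (u : ℝ) : Real.tanh u - 1 = -Real.exp (-u) / Real.cosh u := by
  rw [Real.tanh_eq_sinh_div_cosh, div_sub_one (Real.cosh_pos u).ne', Real.sinh_sub_cosh]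

lemma tanh_add_one (u : ℝ) : Real.tanh u + 1 = Real.exp u / Real.cosh u := by
  rw [Real.tanh_eq_sinh_div_cosh, div_add_one (Real.cosh_pos u).ne', Real.sinh_add_cosh]

/-- Bayes' rule for a binary input. -/
lemma binary_bayes (v a : ℝ) :
    halfGaussianPDF (v + a) * (Real.tanh (2 * a * v) + 1)
      + halfGaussianPDF (v - a) * (Real.tanh (2 * a * v) - 1) = 0 := by
  have h := halfGaussianPDF_sub v (-a)
  rw [sub_neg_eq_add] at h
  rw [h, halfGaussianPDF_sub, tanh_add_one, tanh_sub_one, neg_sq,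
    show 2 * -a * v = -(2 * a * v) by ring]
  ring

/-- The conditional squared error for a binary input. -/
lemma binary_error (v a : ℝ) :
    halfGaussianPDF (v + a) * (Real.tanh (2 * a * v) + 1) ^ 2
      + halfGaussianPDF (v - a) * (Real.tanh (2 * a * v) - 1) ^ 2
      = 2 * (halfGaussianPDF v * (Real.exp (-a ^ 2) / Real.cosh (2 * a * v))) := by
  have h := halfGaussianPDF_sub v (-a)
  rw [sub_neg_eq_add] at h
  have h1 : Real.exp (2 * a * v) * Real.exp (-(2 * a * v)) = 1 := by
    rw [← Real.exp_add]; simp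
  have h2 := Real.cosh_eq (2 * a * v)
  have h3 := (Real.cosh_pos (2 * a * v)).ne'
  rw [h, halfGaussianPDF_sub, tanh_add_one, tanh_sub_one, neg_sq,
    show 2 * -a * v = -(2 * a * v) by ring, div_pow, div_pow]
  -- Only `E₁ E₂ = 1` and `E₁ + E₂ = 2c` are needed from here on.
  generalize Real.exp (2 * a * v) = E₁ at *
  generalize Real.exp (-(2 * a * v)) = E₂ at *
  generalize Real.cosh (2 * a * v) = c at *
  generalize Real.exp (-a ^ 2) = G
  field_simp
  linear_combination (halfGaussianPDF v * G) * ((E₁ + E₂) * h1 - 2 * h2)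

/-- Rescale by `v = a s`, so that the two exponentials merge into `e^{-(1 + s²) a²}`, and fold the
even integrand onto `(0, ∞)`. -/
lemma integral_binary_error {a : ℝ} (ha : 0 < a) :
    ∫ v, halfGaussianPDF v * (Real.exp (-a ^ 2) / Real.cosh (2 * a * v)) = binaryMMSE (a ^ 2) := by
  have h1 := Measure.integral_comp_mul_left
    (fun v => halfGaussianPDF v * (Real.exp (-a ^ 2) / Real.cosh (2 * a * v))) a
  rw [abs_of_pos (inv_pos.2 ha), smul_eq_mul, eq_comm, inv_mul_eq_iff_eq_mul₀ ha.ne'] at h1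
  have h2 := integral_comp_abs (f := fun s =>
    halfGaussianPDF (a * s) * (Real.exp (-a ^ 2) / Real.cosh (2 * a * (a * s))))
  have h3 : ∀ s : ℝ, halfGaussianPDF (a * |s|) *
      (Real.exp (-a ^ 2) / Real.cosh (2 * a * (a * |s|)))
      = halfGaussianPDF (a * s) * (Real.exp (-a ^ 2) / Real.cosh (2 * a * (a * s))) := by
    intro s
    have : Real.cosh (2 * a * (a * |s|)) = Real.cosh (2 * a * (a * s)) := by
      rw [← Real.cosh_abs (2 * a * (a * s))]
      congr 1
      rw [abs_mul, abs_mul a s, abs_of_pos ha, abs_of_pos (by linarith : 0 < 2 * a)]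
    rw [this, halfGaussianPDF_eq, halfGaussianPDF_eq, mul_pow, mul_pow, sq_abs]
  simp_rw [h3] at h2
  rw [h1, h2, ← mul_assoc, ← integral_const_mul, binaryMMSE]
  refine integral_congr_ae (Eventually.of_forall fun s => ?_)
  simp only
  rw [halfGaussianPDF_eq, Real.sqrt_div (sq_nonneg a), Real.sqrt_sq ha.le,
    show -((1 + s ^ 2) * a ^ 2) = -(a * s) ^ 2 + -a ^ 2 by ring, Real.exp_add,
    show 2 * a ^ 2 * s = 2 * a * (a * s) by ring]
  ring

lemma integrable_binary_error (a : ℝ) :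
    Integrable fun v => halfGaussianPDF v * (Real.exp (-a ^ 2) / Real.cosh (2 * a * v)) := by
  refine integrable_halfGaussianPDF.mul_bdd (c := 1)
    (Measurable.aestronglyMeasurable (by fun_prop)) (Eventually.of_forall fun v => ?_)
  rw [Real.norm_of_nonneg (by positivity), div_le_one (by positivity)]
  exact (Real.exp_le_one_iff.2 (by nlinarith)).trans (Real.one_le_cosh _)

section
variable {Ω : Type*} [MeasurableSpace Ω] {P : Measure Ω} {x n : Ω → ℂ}

/-- Only the real part of the output is informative; the density of the imaginary part factors out
and integrates to `1`. -/
lemma canonicalMMSE_binary [IsProbabilityMeasure P] (hx : Measurable x) (hn : Measurable n)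
    (hxn : IndepFun x n P) (hnoise : P.map n = stdComplexGaussian) {r : ℝ} (hr : 0 < r)
    (hlaw : P.map x = uniformOn ({-(r : ℂ), (r : ℂ)} : Set ℂ)) {t : ℝ} (ht : 0 < t) :
    canonicalMMSE P x n t = r ^ 2 * binaryMMSE (r ^ 2 * t) := by
  set a := Real.sqrt t * r with ha
  have ha0 : 0 < a := mul_pos (Real.sqrt_pos.2 ht) hr
  have ha2 : a ^ 2 = r ^ 2 * t := by rw [ha, mul_pow, Real.sq_sqrt ht.le, mul_comm]
  have hne : -(r : ℂ) ≠ r := by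
    rw [Ne, neg_eq_self]
    exact_mod_cast hr.ne'
  set g : ℂ → ℂ := fun y => ((r * Real.tanh (2 * a * y.re) : ℝ) : ℂ) with hg
  have hgm : Measurable g := by fun_prop
  have hgb : ∀ y, ‖g y‖ ≤ r := by
    intro y
    rw [hg, Complex.norm_real, norm_mul, Real.norm_of_nonneg hr.le]
    exact mul_le_of_le_one_right hr.le (Real.abs_tanh_lt_one _).le
  have hpos : ∀ p, channelPDF ((Real.sqrt t : ℂ) * r) p
      = halfGaussianPDF (p.1 - a) * halfGaussianPDF p.2 := by
    intro p; simp [channelPDF, ha]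
  have hneg : ∀ p, channelPDF ((Real.sqrt t : ℂ) * -r) p
      = halfGaussianPDF (p.1 + a) * halfGaussianPDF p.2 := by
    intro p; simp [channelPDF, ha]
  have hgp : ∀ p : ℝ × ℝ, g (Complex.measurableEquivRealProd.symm p)
      = ((r * Real.tanh (2 * a * p.1) : ℝ) : ℂ) := fun p => rfl
  rw [canonicalMMSE_eq_integral hx hn hxn hnoise (s := {-(r : ℂ), (r : ℂ)}) (by simp)
    (by simpa using hlaw) t hgm hgb, Finset.card_pair hne]
  · have h1 : ∀ p : ℝ × ℝ, ∑ b ∈ ({-(r : ℂ), (r : ℂ)} : Finset ℂ),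
        channelPDF ((Real.sqrt t : ℂ) * b) p *
          ‖b - g (Complex.measurableEquivRealProd.symm p)‖ ^ 2
        = 2 * r ^ 2 * ((halfGaussianPDF p.1 * (Real.exp (-a ^ 2) / Real.cosh (2 * a * p.1)))
          * halfGaussianPDF p.2) := by
      intro p
      rw [Finset.sum_pair hne, hpos, hneg, hgp, ← Complex.ofReal_neg, ← Complex.ofReal_sub,
        ← Complex.ofReal_sub, Complex.norm_real, Complex.norm_real, Real.norm_eq_abs,
        Real.norm_eq_abs, sq_abs, sq_abs]
      linear_combination (r ^ 2 * halfGaussianPDF p.2) * binary_error p.1 a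
    simp_rw [h1]
    rw [integral_const_mul, Measure.volume_eq_prod,
      integral_prod_mul (fun v => halfGaussianPDF v * (Real.exp (-a ^ 2) / Real.cosh (2 * a * v))),
      integral_binary_error ha0, integral_halfGaussianPDF, ha2]
    push_cast
    ring
  · intro p
    rw [Finset.sum_pair hne, hpos, hneg, hgp]
    have := congrArg (fun u : ℝ => (u : ℂ)) (binary_bayes p.1 a)
    push_cast at this ⊢
    linear_combination (r * halfGaussianPDF p.2 : ℂ) * this

/-- As a product set, the constellation lets sums over it split by coordinate. -/
lemma qpskConstellation_eq :
    qpskConstellation = ((((({-(1 / Real.sqrt 2), 1 / Real.sqrt 2} : Finset ℝ) ×ˢ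
      {-(1 / Real.sqrt 2), 1 / Real.sqrt 2}).map
        Complex.equivRealProd.symm.toEmbedding : Finset ℂ)) : Set ℂ) := by
  have h : (1 / (Real.sqrt 2 : ℂ)) = ((1 / Real.sqrt 2 : ℝ) : ℂ) := by push_cast; rfl
  ext y
  simp only [qpskConstellation, h]
  generalize 1 / Real.sqrt 2 = ρ
  simp only [Set.mem_insert_iff, Set.mem_singleton_iff, Complex.ext_iff, Finset.coe_map,
    Set.mem_image, Finset.mem_coe, Finset.mem_product, Finset.mem_insert, Finset.mem_singleton,
    Prod.exists, Equiv.coe_toEmbedding, Complex.equivRealProd_symm_apply]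
  simp
  grind

lemma canonicalMMSE_qpsk [IsProbabilityMeasure P] (hx : Measurable x) (hn : Measurable n)
    (hxn : IndepFun x n P) (hnoise : P.map n = stdComplexGaussian)
    (hlaw : P.map x = uniformOn qpskConstellation) {t : ℝ} (ht : 0 < t) :
    canonicalMMSE P x n t = binaryMMSE (1 / 2 * t) := by
  rw [qpskConstellation_eq] at hlaw
  have hr : 0 < 1 / Real.sqrt 2 := by positivity
  have hr2 : (1 / Real.sqrt 2) ^ 2 = 1 / 2 := by
    rw [div_pow, Real.sq_sqrt (by norm_num)]; norm_num
  generalize 1 / Real.sqrt 2 = r at hlaw hr hr2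
  set a := Real.sqrt t * r with ha
  have ha0 : 0 < a := mul_pos (Real.sqrt_pos.2 ht) hr
  have ha2 : a ^ 2 = 1 / 2 * t := by rw [ha, mul_pow, Real.sq_sqrt ht.le, mul_comm, hr2]
  have hne : -r ≠ r := by linarith
  set g : ℂ → ℂ := fun y => ((r * Real.tanh (2 * a * y.re) : ℝ) : ℂ)
    + ((r * Real.tanh (2 * a * y.im) : ℝ) : ℂ) * Complex.I with hg
  have hgm : Measurable g := by fun_prop
  have hT : ∀ u : ℝ, ‖((r * Real.tanh u : ℝ) : ℂ)‖ ≤ r := by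
    intro u
    rw [Complex.norm_real, norm_mul, Real.norm_of_nonneg hr.le]
    exact mul_le_of_le_one_right hr.le (Real.abs_tanh_lt_one _).le
  have hgb : ∀ y, ‖g y‖ ≤ r + r := by
    intro y
    refine (norm_add_le _ _).trans (add_le_add (hT _) ?_)
    rw [norm_mul, Complex.norm_I, mul_one]
    exact hT _
  have hpdf : ∀ (b c : ℝ) (p : ℝ × ℝ),
      channelPDF ((Real.sqrt t : ℂ) * Complex.equivRealProd.symm (b, c)) p
      = halfGaussianPDF (p.1 - Real.sqrt t * b) * halfGaussianPDF (p.2 - Real.sqrt t * c) := by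
    intro b c p; simp [channelPDF]
  have hneg : ∀ v, v - Real.sqrt t * -r = v + a := by intro v; rw [ha]; ring
  have hgp : ∀ p : ℝ × ℝ, g (Complex.measurableEquivRealProd.symm p)
      = Complex.equivRealProd.symm
        (r * Real.tanh (2 * a * p.1), r * Real.tanh (2 * a * p.2)) := by
    intro p
    apply Complex.ext <;> simp [hg]
  have hsub : ∀ b c b' c' : ℝ, ‖Complex.equivRealProd.symm (b, c)
      - Complex.equivRealProd.symm (b', c')‖ ^ 2 = (b - b') ^ 2 + (c - c') ^ 2 := by
    intro b c b' c'
    rw [Complex.sq_norm, Complex.normSq_apply]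
    simp
    ring
  rw [canonicalMMSE_eq_integral hx hn hxn hnoise (by simp) hlaw t hgm hgb, Finset.card_map,
    Finset.card_product, Finset.card_pair hne]
  -- `A` is the error of one coordinate and `Z` the total likelihood of the other, of integral `2`.
  -- The two cross terms thus give `4 binaryMMSE`, matching the four points.
  · set A : ℝ → ℝ := fun v =>
      halfGaussianPDF v * (Real.exp (-a ^ 2) / Real.cosh (2 * a * v)) with hA
    set Z : ℝ → ℝ := fun v => halfGaussianPDF (v + a) + halfGaussianPDF (v - a) with hZ
    have hAint : Integrable A := integrable_binary_error a
    have hZ1 := integrable_halfGaussianPDF.comp_add_right a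
    have hZ2 := integrable_halfGaussianPDF.comp_sub_right a
    have hZint : Integrable Z := hZ1.add hZ2
    have hZi : ∫ v, Z v = 2 := by
      rw [hZ, integral_add hZ1 hZ2, integral_add_right_eq_self halfGaussianPDF,
        integral_sub_right_eq_self halfGaussianPDF, integral_halfGaussianPDF]
      norm_num
    have h1 : ∀ p : ℝ × ℝ, ∑ b ∈ (({-r, r} : Finset ℝ) ×ˢ {-r, r}).map
          Complex.equivRealProd.symm.toEmbedding, channelPDF ((Real.sqrt t : ℂ) * b) p *
          ‖b - g (Complex.measurableEquivRealProd.symm p)‖ ^ 2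
        = A p.1 * Z p.2 + Z p.1 * A p.2 := by
      intro p
      simp only [Finset.sum_map, Finset.sum_product, Finset.sum_pair hne, Equiv.coe_toEmbedding,
        hpdf, hgp, hsub, hneg, ← ha, hA, hZ]
      have e1 := binary_error p.1 a
      have e2 := binary_error p.2 a
      linear_combination (r ^ 2 * (halfGaussianPDF (p.2 + a) + halfGaussianPDF (p.2 - a))) * e1
        + (r ^ 2 * (halfGaussianPDF (p.1 + a) + halfGaussianPDF (p.1 - a))) * e2
        + 2 * (A p.1 * Z p.2 + Z p.1 * A p.2) * hr2
    simp_rw [h1]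
    rw [Measure.volume_eq_prod, integral_add (hAint.mul_prod hZint) (hZint.mul_prod hAint),
      integral_prod_mul A Z, integral_prod_mul Z A, hZi, integral_binary_error ha0, ha2]
    push_cast
    ring
  · intro p
    simp only [Finset.sum_map, Finset.sum_product, Finset.sum_pair hne, Equiv.coe_toEmbedding,
      hpdf, hgp, hneg, ← ha]
    simp only [Complex.equivRealProd_symm_apply]
    have e1 := congrArg (fun u : ℝ => (u : ℂ)) (binary_bayes p.1 a)
    have e2 := congrArg (fun u : ℝ => (u : ℂ)) (binary_bayes p.2 a)
    push_cast at e1 e2 ⊢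
    linear_combination (r * (halfGaussianPDF (p.2 + a) + halfGaussianPDF (p.2 - a)) : ℂ) * e1
      + (r * (halfGaussianPDF (p.1 + a) + halfGaussianPDF (p.1 - a)) * Complex.I : ℂ) * e2

end

/-! ### Rescaling and assembly of the three cases -/

lemma HasMellin.const_mul_comp_mul_left {f B : ℝ → ℝ} {s M : ℂ} {c k : ℝ} (hk : 0 < k)
    (hB : HasMellin (fun t => (B t : ℂ)) s M) (hf : ∀ t, 0 < t → f t = c * B (k * t)) :
    HasMellin (fun t => (f t : ℂ)) s (c * ((k : ℂ) ^ (-s) * M)) := by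
  have h1 : MellinConvergent (fun t => (c : ℂ) • (B (k * t) : ℂ)) s :=
    ((MellinConvergent.comp_mul_left (f := fun t => (B t : ℂ)) hk).2 hB.1).const_smul _
  have h2 : mellin (fun t => (c : ℂ) • (B (k * t) : ℂ)) s = c * ((k : ℂ) ^ (-s) * M) := by
    rw [mellin_const_smul, mellin_comp_mul_left (fun t => (B t : ℂ)) s hk, hB.2, smul_eq_mul,
      smul_eq_mul]
  have h3 : Set.EqOn (fun t : ℝ => (t : ℂ) ^ (s - 1) • (f t : ℂ))
      (fun t : ℝ => (t : ℂ) ^ (s - 1) • ((c : ℂ) • (B (k * t) : ℂ))) (Set.Ioi 0) := by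
    intro t ht
    simp [hf t ht]
  constructor
  · rw [MellinConvergent, integrableOn_congr_fun h3 measurableSet_Ioi]
    exact h1
  · rw [mellin, setIntegral_congr_fun measurableSet_Ioi h3]
    exact h2

lemma hypergeometricTerm_zero (z : ℂ) : hypergeometricTerm z 0 = 1 := by
  simp [hypergeometricTerm]

lemma exists_sum_hypergeometricTerm {z : ℂ} (hz : 0 < z.re) :
    ∃ S : ℂ, Tendsto (fun L : ℕ => ∑ l ∈ Finset.Icc 1 L, hypergeometricTerm z l) atTop (𝓝 S) ∧
      HasMellin (fun t => (binaryMMSE t : ℂ)) (1 + z)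
        (2 * (Complex.Gamma (3 / 2 + z) / ((Real.sqrt Real.pi : ℂ) * (1 + z))) * (1 + S)) := by
  have hz1 : 1 + z ≠ 0 := by
    intro h
    have := congrArg Complex.re h
    simp at this
    linarith
  have hp : (Real.sqrt Real.pi : ℂ) ≠ 0 := by
    exact_mod_cast (Real.sqrt_pos.2 Real.pi_pos).ne'
  have hg : Complex.Gamma (3 / 2 + z) ≠ 0 := Complex.Gamma_ne_zero_of_re_pos (by
    simp
    linarith)
  have hM := hasMellin_binaryMMSE hz
  have hlim := tendsto_sum_hypergeometricTerm hz
  set I := ∫ p, mellinKernel z p * ((1 / (2 * Real.cosh (2 * p.2 * p.1)) : ℝ) : ℂ)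
    ∂quadrantMeasure
  set κ := Complex.Gamma (3 / 2 + z) / (2 * (1 + z)) with hκ
  have hκ0 : κ ≠ 0 := div_ne_zero hg (mul_ne_zero two_ne_zero hz1)
  refine ⟨κ⁻¹ * I - 1, ?_, ?_⟩
  -- Shifting `L` by one turns `range (L + 1)` into `{0}` together with `Icc 1 L`; the term `l = 0`
  -- equals `1` and is subtracted.
  · have h1 := ((hlim.const_mul κ⁻¹).comp (tendsto_add_atTop_nat 1)).sub_const 1
    refine h1.congr fun L => ?_
    simp only [Function.comp_apply]
    rw [inv_mul_cancel_left₀ hκ0, Finset.range_eq_Ico, Finset.sum_eq_sum_Ico_succ_bot (by omega),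
      hypergeometricTerm_zero, add_sub_cancel_left]
    rfl
  · convert hM using 1
    rw [hκ]
    generalize Complex.Gamma (3 / 2 + z) = G at *
    field_simp
    ring

/-- Reduces power identities with positive bases to linear identities between logarithms. -/
lemma ofReal_cpow_eq_exp {u : ℝ} (hu : 0 < u) (w : ℂ) :
    (u : ℂ) ^ w = Complex.exp ((Real.log u : ℂ) * w) := by
  rw [Complex.cpow_def_of_ne_zero (by exact_mod_cast hu.ne'), Complex.ofReal_log hu.le]

lemma half_sq_cpow {d : ℝ} (hd : 0 < d) (w : ℂ) :
    (((d / 2) ^ 2 : ℝ) : ℂ) ^ (-w) = (2 / (d : ℂ)) ^ (2 * w) := by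
  have h : (2 / (d : ℂ)) = ((2 / d : ℝ) : ℂ) := by push_cast; rfl
  rw [h, ofReal_cpow_eq_exp (by positivity), ofReal_cpow_eq_exp (by positivity), Real.log_pow,
    Real.log_div hd.ne' two_ne_zero, Real.log_div two_ne_zero hd.ne']
  congr 1
  push_cast
  ring

lemma two_div_cpow_mul {d : ℝ} (hd : 0 < d) (z : ℂ) :
    (2 / (d : ℂ)) ^ (2 * (1 + z)) * (2 : ℂ) ^ (-1 - 2 * z) = 2 * (d : ℂ) ^ (-2 * (1 + z)) := by
  have h : (2 / (d : ℂ)) = ((2 / d : ℝ) : ℂ) := by push_cast; rfl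
  have h2 : (2 : ℂ) = ((2 : ℝ) : ℂ) := by push_cast; rfl
  have h3 : (2 : ℂ) * (d : ℂ) ^ (-2 * (1 + z))
      = ((2 : ℝ) : ℂ) ^ (1 : ℂ) * (d : ℂ) ^ (-2 * (1 + z)) := by simp
  rw [h3, h, show (2 : ℂ) ^ (-1 - 2 * z) = ((2 : ℝ) : ℂ) ^ (-1 - 2 * z) by simp,
    ofReal_cpow_eq_exp (by positivity), ofReal_cpow_eq_exp two_pos, ofReal_cpow_eq_exp hd,
    ofReal_cpow_eq_exp two_pos, ← Complex.exp_add, ← Complex.exp_add,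
    Real.log_div two_ne_zero hd.ne']
  congr 1
  push_cast
  ring

theorem mainTheorem10 {Ω : Type*} [MeasurableSpace Ω] (P : Measure Ω) [IsProbabilityMeasure P]
    (x n : Ω → ℂ) (hx : Measurable x) (hn : Measurable n) (hxn : IndepFun x n P)
    (hnoise : P.map n = stdComplexGaussian) (z : ℂ) (hz : 0 < z.re) :
    ∃ S : ℂ,
      Tendsto (fun L : ℕ => ∑ l ∈ Finset.Icc 1 L, hypergeometricTerm z l) atTop (𝓝 S) ∧
      (∀ d : ℝ, 0 < d → P.map x = uniformOn ({-((d : ℂ) / 2), (d : ℂ) / 2} : Set ℂ) →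
        HasMellin (fun t : ℝ => (canonicalMMSE P x n t : ℂ)) (1 + z)
          ((d : ℂ) ^ 2 / 2 *
            ((2 / (d : ℂ)) ^ (2 * (1 + z)) *
                (Complex.Gamma (3 / 2 + z) / ((Real.sqrt Real.pi : ℂ) * (1 + z)))
              + 2 * (d : ℂ) ^ (-2 * (1 + z)) *
                (Complex.Gamma (2 + 2 * z) / Complex.Gamma (2 + z)) * S))) ∧
      (P.map x = uniformOn ({-1, 1} : Set ℂ) →
        HasMellin (fun t : ℝ => (canonicalMMSE P x n t : ℂ)) (1 + z)
          (2 * (Complex.Gamma (3 / 2 + z) / ((Real.sqrt Real.pi : ℂ) * (1 + z))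
              + (2 : ℂ) ^ (-1 - 2 * z) *
                (Complex.Gamma (2 + 2 * z) / Complex.Gamma (2 + z)) * S))) ∧
      (P.map x = uniformOn qpskConstellation →
        HasMellin (fun t : ℝ => (canonicalMMSE P x n t : ℂ)) (1 + z)
          ((2 : ℂ) ^ (2 + z) * (Complex.Gamma (3 / 2 + z) / ((Real.sqrt Real.pi : ℂ) * (1 + z))
              + (2 : ℂ) ^ (-1 - 2 * z) *
                (Complex.Gamma (2 + 2 * z) / Complex.Gamma (2 + z)) * S))) := by
  obtain ⟨S, hS, hM⟩ := exists_sum_hypergeometricTerm hz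
  have hdup := two_cpow_mul_Gamma_div_Gamma hz
  refine ⟨S, hS, fun d hd hlaw => ?_, fun hlaw => ?_, fun hlaw => ?_⟩
  · have h := HasMellin.const_mul_comp_mul_left (k := (d / 2) ^ 2) (by positivity) hM
      fun t ht => canonicalMMSE_binary hx hn hxn hnoise (r := d / 2) (by positivity)
        (by push_cast; exact hlaw) ht
    convert h using 1
    -- After this and duplication, the coefficient of `S` equals the first term, so `1 + S` factors
    -- out.
    rw [half_sq_cpow hd, ← two_div_cpow_mul hd, mul_assoc _ ((2 : ℂ) ^ (-1 - 2 * z)), hdup]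
    push_cast
    ring
  · have h := HasMellin.const_mul_comp_mul_left (k := 1 ^ 2) (by positivity) hM
      fun t ht => canonicalMMSE_binary hx hn hxn hnoise (r := 1) one_pos
        (by push_cast; exact hlaw) ht
    convert h using 1
    rw [hdup]
    simp
    ring
  · have h := HasMellin.const_mul_comp_mul_left (f := canonicalMMSE P x n) (k := 1 / 2) (c := 1)
      (by positivity) hM
      fun t ht => by rw [one_mul]; exact canonicalMMSE_qpsk hx hn hxn hnoise hlaw ht
    convert h using 1
    -- The scaling factor of `t ↦ t/2`, times the `2` in the transform of `binaryMMSE`.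
    have h2 : (((1 / 2 : ℝ)) : ℂ) ^ (-(1 + z)) * 2 = (2 : ℂ) ^ (2 + z) := by
      have h3 : (((1 / 2 : ℝ)) : ℂ) ^ (-(1 + z)) = (2 : ℂ) ^ (1 + z) := by
        rw [show (2 : ℂ) = ((2 : ℝ) : ℂ) by simp, ofReal_cpow_eq_exp (by norm_num),
          ofReal_cpow_eq_exp two_pos, one_div, Real.log_inv]
        congr 1
        push_cast
        ring
      rw [h3, show 2 + z = (1 + z) + 1 by ring, Complex.cpow_add (1 + z) 1 two_ne_zero,
        Complex.cpow_one]
    rw [hdup, ← h2]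
    push_cast
    ring
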